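/- Let $D$ be a unique factorization domain with field of fractions $F$ ($D=F$ is allowed). Let $m_1,\dots,m_\ell$ be positive integers, $m=\mathrm{lcm}\{m_1,\dots,m_\ell\}$, and $N_1,\dots,N_\ell\in D$. For each $i$ let $\sqrt[m_i]{N_i}$ be any $m_i$-th root of $N_i$ in a fixed extension field of $F$. For a prime $p\mid m$ let $J(p)=\{i : p\mid m_i\}=\{i_1<\dots<i_r\}$ and $$S(p)=\{N_{i_1}^{e_1}\cdots N_{i_{k-1}}^{e_{k-1}}N_{i_k} : 1\le k\le r,\ 0\le e_j<p\},\qquad D^p=\{x^p : x\in D\}.$$ If $2\mid m$, the tuple $(N_i)_{i\in J(2)}$ is called 2-defective if the following hold: $S(2)\cap D^2=\emptyset$; $S(2)\cap(-D^2)\neq\emptyset$; and, whenever $-d^2=\prod_{i\in J(2)}N_i^{f_i}$ with $d\in D$, $f_i\in\{0,1\}$ not all zero, every $i\in J(2)$ with $f_i=1$ satisfies $4\mid m_i$ and, for some choice of a sign and of $e_j\in\{0,1\}$, $$\pm 2d\prod_{j\in J(2),\,j\ne i}N_j^{e_j}\in D^2 .$$ Theorem C. Assume that the characteristic of $F$ does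 not divide $m$. Then $$[F[\sqrt[m_1]{N_1},\dots,\sqrt[m_\ell]{N_\ell}]:F]=m_1\cdots m_\ell$$ if and only if $S(p)\cap D^p=\emptyset$ for every prime $p\mid m$ and, if $2\mid m$, the tuple $(N_i)_{i\in J(2)}$ is not 2-defective. -/

import Mathlib

namespace RadicalExt

/-- `D^p`, the set of `p`-th powers of elements of `D`. -/
def powSet (D : Type*) [CommRing D] (p : ℕ) : Set D :=
  {x | ∃ y : D, x = y ^ p}

/-- `-D^2`, the set of negatives of squares of elements of `D`. -/
def negSqSet (D : Type*) [CommRing D] : Set D :=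
  {x | ∃ y : D, x = -y ^ 2}

/-- `J(p) = {i | p divides m_i}`. -/
def idx {ℓ : ℕ} (m : Fin ℓ → ℕ) (p : ℕ) : Finset (Fin ℓ) :=
  Finset.univ.filter (fun i => p ∣ m i)

/-- The set `S_p` of the subtuple `(N_i)_{i ∈ J}`, in increasing order of the indices: all products
`N_{j_1}^{e_1} ⋯ N_{j_{k-1}}^{e_{k-1}} N_{j_k}` with `0 ≤ e_j < p`, where
`j_1 < ⋯ < j_{k-1}` are all the elements of `J` that are smaller than `j_k ∈ J`. -/
def prodSet {D : Type*} [CommRing D] {ℓ : ℕ} (p : ℕ) (J : Finset (Fin ℓ)) (N : Fin ℓ → D) :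
    Set D :=
  {x | ∃ k ∈ J, ∃ e : Fin ℓ → ℕ, (∀ j, e j < p) ∧
    x = (∏ j ∈ J.filter (fun j => j < k), N j ^ e j) * N k}

/-- The subtuple `(N_i)_{i ∈ J}`, with exponents `(m_i)_{i ∈ J}`, is 2-defective:
`S_2` contains no square, it contains the negative of a square, and whenever
`∏_{i ∈ J} N_i^{f_i} = -d^2` with all `f_i ∈ {0, 1}`, every `i ∈ J` with `f_i = 1` satisfies
`4 ∣ m_i` and `± 2 d ∏_{j ≠ i} N_j^{e_j}` is a square for some sign and some `e_j ∈ {0, 1}`. -/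
def IsTwoDefective {D : Type*} [CommRing D] {ℓ : ℕ} (J : Finset (Fin ℓ)) (m : Fin ℓ → ℕ)
    (N : Fin ℓ → D) : Prop :=
  prodSet 2 J N ∩ powSet D 2 = ∅ ∧
  (prodSet 2 J N ∩ negSqSet D).Nonempty ∧
  ∀ (f : Fin ℓ → ℕ) (d : D), (∀ i, f i < 2) → ∏ i ∈ J, N i ^ f i = -d ^ 2 →
    ∀ i ∈ J, f i = 1 →
      4 ∣ m i ∧
      ∃ e : Fin ℓ → ℕ, (∀ j, e j < 2) ∧
        (2 * d * ∏ j ∈ J.erase i, N j ^ e j ∈ powSet D 2 ∨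
          -(2 * d * ∏ j ∈ J.erase i, N j ^ e j) ∈ powSet D 2)

end RadicalExt

/-!
The proof rests on one notion, `IsIndep p L T N`: the elements `N i` are independent in the
multiplicative group of the field `L` modulo `p`-th powers and signs.

*Climbing.* Let `b` be a `p`-th root of a member `N k` of an independent family. Then `L(b)` has
degree `p` over `L`, and replacing `N k` by `b` gives a family that is independent over `L(b)`
(`IsIndep.update`): the norm of `b` is `± N k`, which controls the exponent of `b` in a relation, and
the kernel of `Lˣ / p → L(b)ˣ / p` is generated by `N k` (`exists_eq_mul_pow`). The last fact is
proved with the trace, so that no roots of unity have to be adjoined. By induction, adjoining roots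
of `p`-power order to an independent family always has the full degree (`IsIndep.tower`).

*Sufficiency.* As `D` is integrally closed, `S(p) ∩ D ^ p = ∅` says that the `N i`, `i ∈ J(p)`, are
independent modulo `p`-th powers of `F` (`exists_mem_prodSet`). For odd `p` signs are `p`-th powers
and the tower applies over `F`; for `p = 2` it does if moreover `S(2)` contains no negative of a
square. Otherwise `-1` is a product of some `N i` up to squares, so that `√-1` lies in the extension;
there the tower is started over `F(√-1)`, and failing to be 2-defective is what makes a suitably
modified family independent (`two_pow_dvd_relfinrank`). In all cases the `p`-part of `∏ i, m i`
divides the degree, which is at most `∏ i, m i`.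

*Necessity.* If the degree is `∏ i, m i`, then `X ^ m k - N k` is irreducible over the field generated
by the `α j` with `j ≠ k`. Hence `N k` is neither a `p`-th power there, for `p ∣ m k`, nor of the form
`-4 * c ^ 4`, if `4 ∣ m k`. An element of `S(p) ∩ D ^ p` would give the former, and a 2-defective
tuple the latter (`not_isTwoDefective_of_full`).
-/

namespace RadicalExt

open Polynomial IntermediateField

/-! ### Simple radical extensions of prime degree -/

section Simple

variable {K E : Type*} [Field K] [Field E] [Algebra K E] {p : ℕ} {a : K} {b : E}

lemma minpoly_eq_X_pow_sub_C (hp : p.Prime) (ha : ∀ x : K, x ^ p ≠ a)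
    (hb : b ^ p = algebraMap K E a) : minpoly K b = X ^ p - C a :=
  (minpoly.eq_of_irreducible_of_monic (X_pow_sub_C_irreducible_of_prime hp ha)
    (by simp [hb]) (monic_X_pow_sub_C a hp.ne_zero)).symm

lemma isIntegral_of_pow_eq {n : ℕ} (hn : 0 < n) (hb : b ^ n = algebraMap K E a) :
    IsIntegral K b :=
  IsIntegral.of_pow hn (hb ▸ isIntegral_algebraMap)

lemma finrank_adjoin_root (hp : p.Prime) (ha : ∀ x : K, x ^ p ≠ a)
    (hb : b ^ p = algebraMap K E a) : Module.finrank K K⟮b⟯ = p := by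
  rw [adjoin.finrank (isIntegral_of_pow_eq hp.pos hb), minpoly_eq_X_pow_sub_C hp ha hb,
    natDegree_X_pow_sub_C]

lemma norm_gen (hp : p.Prime) (ha : ∀ x : K, x ^ p ≠ a) (hb : b ^ p = algebraMap K E a) :
    Algebra.norm K (AdjoinSimple.gen K b) = (-1) ^ (p + 1) * a := by
  have hi := isIntegral_of_pow_eq hp.pos hb
  have h := Algebra.PowerBasis.norm_gen_eq_coeff_zero_minpoly (adjoin.powerBasis hi)
  rw [adjoin.powerBasis_gen, adjoin.powerBasis_dim, minpoly_gen,
    minpoly_eq_X_pow_sub_C hp ha hb, natDegree_X_pow_sub_C] at h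
  rw [h]
  simp [hp.ne_zero.symm, pow_succ]

end Simple

section PrimeDegree

variable {K M : Type*} [Field K] [Field M] [Algebra K M] {p : ℕ}

/-- In an extension of prime degree `p`, an element outside the base field whose `p`-th power lies
in the base field has trace zero: its minimal polynomial is `X ^ p - c`. -/
lemma trace_eq_zero_of_pow_eq (hp : p.Prime) (hfin : Module.finrank K M = p) {y : M} {c : K}
    (hy : y ^ p = algebraMap K M c) (hy' : y ∉ (algebraMap K M).range) :
    Algebra.trace K M y = 0 := by
  have : FiniteDimensional K M := Module.finite_of_finrank_pos (hfin ▸ hp.pos)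
  have hint := isIntegral_of_pow_eq hp.pos hy
  have hd : (minpoly K y).natDegree = p := by
    refine ((Nat.dvd_prime hp).1 ?_).resolve_left fun h => hy' (minpoly.natDegree_eq_one_iff.1 h)
    rw [← hfin]
    exact minpoly.degree_dvd hint
  have hm : minpoly K y = X ^ p - C c := by
    refine (eq_of_monic_of_dvd_of_natDegree_le (minpoly.monic hint)
      (monic_X_pow_sub_C c hp.ne_zero) (minpoly.dvd K y (by simp [hy])) ?_).symm
    rw [hd, natDegree_X_pow_sub_C]
  rw [trace_eq_finrank_mul_minpoly_nextCoeff, hm,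
    nextCoeff_of_natDegree_pos (by rw [natDegree_X_pow_sub_C]; exact hp.pos),
    natDegree_X_pow_sub_C]
  have h1 : p - 1 ≠ p := by have := hp.pos; omega
  have h2 : p - 1 ≠ 0 := by have := hp.two_le; omega
  simp [coeff_X_pow, coeff_C, h1, h2]

/-- If `K(b)/K` has prime degree `p ≠ char K` and `b ^ p ∈ K`, then every `z` with `z ^ p ∈ K` is
a power of `b` up to a factor in `K`. No roots of unity are needed: otherwise every `z * b ^ t`
has trace zero, so `z` is orthogonal to `K(b)` for the trace form, and in particular `1 = z * z⁻¹`
has trace zero, whereas its trace is `p`. -/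
lemma exists_eq_mul_pow (hp : p.Prime) (hpK : (p : K) ≠ 0) (hfin : Module.finrank K M = p)
    {b : M} {a : K} (hb : b ^ p = algebraMap K M a) (hgen : K⟮b⟯ = ⊤) {z : M} {c : K}
    (hz : z ^ p = algebraMap K M c) (hz0 : z ≠ 0) :
    ∃ (w : K) (t : ℕ), z = algebraMap K M w * b ^ t := by
  by_contra! hcon
  have : FiniteDimensional K M := Module.finite_of_finrank_pos (hfin ▸ hp.pos)
  have hb0 : b ≠ 0 := by
    rintro rfl
    rw [adjoin_zero] at hgen
    have h1 := IntermediateField.finrank_top' (F := K) (E := M)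
    rw [← hgen, IntermediateField.finrank_bot, hfin] at h1
    exact hp.one_lt.ne h1
  have ha0 : algebraMap K M a ≠ 0 := hb ▸ pow_ne_zero p hb0
  have htr : ∀ t : ℕ, Algebra.trace K M (z * b ^ t) = 0 := by
    intro t
    refine trace_eq_zero_of_pow_eq hp hfin (c := c * a ^ t) ?_ ?_
    · rw [mul_pow, hz, ← pow_mul, mul_comm t, pow_mul, hb]
      simp
    · rintro ⟨w, hw⟩
      -- `b ^ ((p - 1) * t) / a ^ t` is the inverse of `b ^ t`
      apply hcon (w / a ^ t) ((p - 1) * t)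
      obtain ⟨q, rfl⟩ : ∃ q, p = q + 1 := ⟨p - 1, (Nat.succ_pred_prime hp).symm⟩
      rw [map_div₀, hw, map_pow, ← hb, Nat.add_sub_cancel]
      field_simp
      ring
  have hall : ∀ y ∈ Algebra.adjoin K {b}, Algebra.trace K M (z * y) = 0 := by
    intro y hy
    rw [Algebra.adjoin_singleton_eq_range_aeval] at hy
    obtain ⟨q, rfl⟩ := hy
    change Algebra.trace K M (z * aeval b q) = 0
    rw [aeval_eq_sum_range, Finset.mul_sum, map_sum]
    exact Finset.sum_eq_zero fun i _ => by rw [mul_smul_comm, map_smul, htr, smul_zero]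
  have htop : Algebra.adjoin K {b} = ⊤ := by
    rw [← adjoin_simple_toSubalgebra_of_isAlgebraic (Algebra.IsAlgebraic.isAlgebraic b), hgen,
      top_toSubalgebra]
  have h1 := hall z⁻¹ (htop ▸ Algebra.mem_top)
  rw [mul_inv_cancel₀ hz0, ← map_one (algebraMap K M), Algebra.trace_algebraMap, hfin] at h1
  simp [hpK] at h1

end PrimeDegree

lemma exists_eq_mul_pow_of_mem_adjoin {K E : Type*} [Field K] [Field E] [Algebra K E] {p : ℕ}
    (hp : p.Prime) (hpK : (p : K) ≠ 0) {a : K} {b : E} (ha : ∀ x : K, x ^ p ≠ a)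
    (hb : b ^ p = algebraMap K E a) {z : E} (hzm : z ∈ K⟮b⟯) {c : K}
    (hz : z ^ p = algebraMap K E c) (hz0 : z ≠ 0) :
    ∃ (w : K) (t : ℕ), z = algebraMap K E w * b ^ t := by
  have hgen : K⟮AdjoinSimple.gen K b⟯ = ⊤ := by
    apply IntermediateField.map_injective K⟮b⟯.val
    rw [adjoin_map, ← AlgHom.fieldRange_eq_map]
    simp
  obtain ⟨w, t, h⟩ := exists_eq_mul_pow (M := K⟮b⟯) hp hpK (finrank_adjoin_root hp ha hb)
    (b := AdjoinSimple.gen K b) (a := a) (Subtype.ext (by simpa using hb)) hgen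
    (z := ⟨z, hzm⟩) (c := c) (Subtype.ext (by simpa using hz)) (by simpa [Subtype.ext_iff] using hz0)
  exact ⟨w, t, by simpa using congrArg Subtype.val h⟩

/-! ### Independence modulo `p`-th powers and towers of radical extensions -/

section Tower

variable {F E ι : Type*} [Field F] [Field E] [Algebra F E] {p : ℕ}

/-- The elements `N i`, `i ∈ T`, are independent in `Lˣ` modulo `p`-th powers *and signs*: a
product of powers of them is `± z ^ p` with `z ∈ L` only if all exponents are divisible by `p`.
Exponents are natural numbers, which suffices as `N i ^ p` is a `p`-th power; taking one exponent
equal to `1` shows that `N i ≠ 0`. For odd `p` the sign is immaterial; for `p = 2` it is what makes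
the notion stable under adjoining a root, see `IsIndep.update`. -/
def IsIndep (p : ℕ) (L : IntermediateField F E) (T : Finset ι) (N : ι → E) : Prop :=
  ∀ (e : ι → ℕ) (ε z : E), (ε = 1 ∨ ε = -1) → z ∈ L → ε * ∏ i ∈ T, N i ^ e i = z ^ p →
    ∀ i ∈ T, p ∣ e i

lemma IsIndep.ne_zero [DecidableEq ι] (hp : p.Prime) {L : IntermediateField F E} {T : Finset ι}
    {N : ι → E} (h : IsIndep p L T N) {i : ι} (hi : i ∈ T) : N i ≠ 0 := by
  intro h0
  have := h (fun _ => 1) 1 0 (Or.inl rfl) (zero_mem _)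
    (by rw [Finset.prod_eq_zero hi (by simp [h0]), mul_zero, zero_pow hp.ne_zero]) i hi
  exact hp.one_lt.ne' (Nat.dvd_one.1 this)

lemma sign_mem {ε : E} (hε : ε = 1 ∨ ε = -1) (L : IntermediateField F E) : ε ∈ L := by
  rcases hε with rfl | rfl
  · exact one_mem L
  · exact neg_mem (one_mem L)

lemma relfinrank_sup_adjoin_simple (L : IntermediateField F E) (b : E) :
    relfinrank L (L ⊔ F⟮b⟯) = Module.finrank L L⟮b⟯ := by
  rw [relfinrank_eq_finrank_of_le le_sup_left]
  have : extendScalars (le_sup_left : L ≤ L ⊔ F⟮b⟯) = L⟮b⟯ := by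
    apply restrictScalars_injective F
    rw [extendScalars_restrictScalars, restrictScalars_adjoin_eq_sup]
  rw [this]

lemma mem_sup_adjoin_simple_iff {L : IntermediateField F E} {b z : E} :
    z ∈ L ⊔ F⟮b⟯ ↔ z ∈ L⟮b⟯ := by
  rw [← restrictScalars_adjoin_eq_sup, mem_restrictScalars]

/-- Adjoining a `p`-th root `b` of one member `N k` of an independent family has degree `p`, and
replacing `N k` by `b` gives a family that is independent over the larger field. Taking norms of a
relation shows that `b` occurs with an exponent divisible by `p`; here `b` has norm `± N k`, which
is where signs enter. The relation then descends by `exists_eq_mul_pow`. -/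
lemma IsIndep.update [DecidableEq ι] (hp : p.Prime) (hpF : (p : F) ≠ 0)
    {L : IntermediateField F E}
    {T : Finset ι} {N : ι → E} (h : IsIndep p L T N) (hN : ∀ i ∈ T, N i ∈ L) {k : ι} (hk : k ∈ T)
    {b : E} (hb : b ^ p = N k) :
    relfinrank L (L ⊔ F⟮b⟯) = p ∧ IsIndep p (L ⊔ F⟮b⟯) T (Function.update N k b) := by
  set a : L := ⟨N k, hN k hk⟩ with ha_def
  have hb' : b ^ p = algebraMap L E a := hb
  have hne : ∀ i ∈ T, N i ≠ 0 := fun i hi => h.ne_zero hp hi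
  have hb0 : b ≠ 0 := fun h0 => hne k hk (by rw [← hb, h0, zero_pow hp.ne_zero])
  have hpL : (p : L) ≠ 0 := by
    intro h0
    apply hpF
    apply (algebraMap F L).injective
    simpa using h0
  have hsplit : ∀ e : ι → ℕ, ∏ i ∈ T, N i ^ e i = N k ^ e k * ∏ i ∈ T.erase k, N i ^ e i :=
    fun e => (Finset.mul_prod_erase T _ hk).symm
  have single : ∀ (n : ℕ) (ε z : E), (ε = 1 ∨ ε = -1) → z ∈ L → ε * N k ^ n = z ^ p → p ∣ n := by
    intro n ε z hε hz hn
    have := h (fun i => if i = k then n else 0) ε z hε hz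
      (by rw [hsplit, Finset.prod_eq_one (fun i hi => by simp [Finset.ne_of_mem_erase hi])]
          simpa using hn) k hk
    simpa using this
  have ha : ∀ x : L, x ^ p ≠ a := by
    intro x hx
    refine hp.one_lt.ne' (Nat.dvd_one.1 (single 1 1 x (Or.inl rfl) x.2 ?_))
    rw [one_mul, pow_one]
    exact (congrArg Subtype.val hx).symm
  refine ⟨(relfinrank_sup_adjoin_simple L b).trans (finrank_adjoin_root hp ha hb'), ?_⟩
  intro e ε z hε hz hrel
  rw [mem_sup_adjoin_simple_iff] at hz
  set P : E := ∏ i ∈ T.erase k, N i ^ e i with hP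
  have hPL : P ∈ L := prod_mem fun i hi => pow_mem (hN i (Finset.mem_of_mem_erase hi)) _
  have hP0 : P ≠ 0 :=
    Finset.prod_ne_zero_iff.2 fun i hi => pow_ne_zero _ (hne i (Finset.mem_of_mem_erase hi))
  have hrel' : ε * (b ^ e k * P) = z ^ p := by
    rw [← hrel, ← Finset.mul_prod_erase T _ hk, Function.update_self]
    congr 2
    exact Finset.prod_congr rfl fun i hi => by
      rw [Function.update_of_ne (Finset.ne_of_mem_erase hi)]
  have hε0 : ε ≠ 0 := by rcases hε with rfl | rfl <;> simp
  have hek : p ∣ e k := by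
    have hfin := finrank_adjoin_root hp ha hb'
    set Q : L := ⟨ε * P, mul_mem (sign_mem hε L) hPL⟩ with hQ
    have h1 : algebraMap L L⟮b⟯ Q * AdjoinSimple.gen L b ^ e k = (⟨z, hz⟩ : L⟮b⟯) ^ p := by
      apply Subtype.ext
      change ε * P * b ^ e k = z ^ p
      rw [← hrel']
      ring
    have h2 := congrArg (Algebra.norm L) h1
    rw [map_mul, map_pow, map_pow, Algebra.norm_algebraMap, hfin, norm_gen hp ha hb'] at h2
    set w := Algebra.norm L (⟨z, hz⟩ : L⟮b⟯)
    have h3 : (ε * P) ^ p * ((-1) ^ (p + 1) * N k) ^ e k = (w : E) ^ p :=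
      congrArg (algebraMap L E) h2
    refine single (e k) (((-1) ^ (p + 1)) ^ e k) (w / (ε * P)) ?_
      (div_mem w.2 (mul_mem (sign_mem hε L) hPL)) ?_
    · rw [← pow_mul]
      exact neg_one_pow_eq_or E _
    · rw [div_pow, ← h3, mul_pow _ (N k)]
      field_simp
  obtain ⟨s, hs⟩ := hek
  have hbs : b ^ e k = N k ^ s := by rw [hs, pow_mul, hb]
  have hz0 : z ≠ 0 := by
    rintro rfl
    rw [zero_pow hp.ne_zero] at hrel'
    exact mul_ne_zero hε0 (mul_ne_zero (pow_ne_zero _ hb0) hP0) hrel'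
  obtain ⟨w, t, hw⟩ := exists_eq_mul_pow_of_mem_adjoin hp hpL ha hb' hz
    (c := ⟨ε * (N k ^ s * P), mul_mem (sign_mem hε L) (mul_mem (pow_mem (hN k hk) _) hPL)⟩)
    (by rw [← hrel', hbs]; rfl) hz0
  -- the relation over `L`; the factor `N k ^ ((p - 1) * t)` avoids the exponent `s - t`
  have hdown := h (fun i => if i = k then s + (p - 1) * t else e i) ε (w * N k ^ t) hε
    (mul_mem w.2 (pow_mem (hN k hk) _)) (by
      rw [hsplit, if_pos rfl, Finset.prod_congr rfl fun i hi => by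
        rw [if_neg (Finset.ne_of_mem_erase hi)]]
      have h4 : ε * (N k ^ s * P) = (w : E) ^ p * N k ^ t := by
        rw [← hbs, hrel', hw, mul_pow, ← pow_mul, mul_comm t, pow_mul, hb]
        rfl
      have h5 : N k ^ ((p - 1) * t) * N k ^ t = (N k ^ t) ^ p := by
        rw [← pow_add, ← pow_mul, mul_comm t p]
        congr 1
        obtain ⟨q, rfl⟩ : ∃ q, p = q + 1 := ⟨p - 1, (Nat.succ_pred_prime hp).symm⟩
        simp only [Nat.add_sub_cancel]
        ring
      calc ε * (N k ^ (s + (p - 1) * t) * P) = ε * (N k ^ s * P) * N k ^ ((p - 1) * t) := by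
            rw [pow_add]; ring
        _ = (w : E) ^ p * (N k ^ ((p - 1) * t) * N k ^ t) := by rw [h4]; ring
        _ = (w * N k ^ t) ^ p := by rw [h5, mul_pow])
  intro i hi
  by_cases hik : i = k
  · exact hik ▸ ⟨s, hs⟩
  · simpa [hik] using hdown i hi

/-- Adjoining `p ^ a i`-th roots of an independent family has the full degree, and the roots are
again independent over the field that they generate. -/
lemma IsIndep.tower [DecidableEq ι] (hp : p.Prime) (hpF : (p : F) ≠ 0) {T : Finset ι} :
    ∀ (n : ℕ) {L : IntermediateField F E} {N α : ι → E} {a : ι → ℕ}, ∑ i ∈ T, a i = n →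
    IsIndep p L T N → (∀ i ∈ T, N i ∈ L) → (∀ i ∈ T, α i ^ p ^ a i = N i) →
    relfinrank L (L ⊔ adjoin F (α '' T)) = p ^ n ∧ IsIndep p (L ⊔ adjoin F (α '' T)) T α := by
  intro n
  induction n with
  | zero =>
    intro L N α a ha h hN hα
    have h1 : ∀ i ∈ T, α i = N i := fun i hi => by
      simpa [Finset.sum_eq_zero_iff.1 ha i hi] using hα i hi
    have h2 : L ⊔ adjoin F (α '' T) = L := by
      refine sup_eq_left.2 (adjoin_le_iff.2 ?_)
      rintro _ ⟨i, hi, rfl⟩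
      exact h1 i hi ▸ hN i hi
    rw [h2]
    refine ⟨by simp, ?_⟩
    intro e ε z hε hz hrel
    exact h e ε z hε hz (by rw [← hrel, Finset.prod_congr rfl fun i hi => by rw [← h1 i hi]])
  | succ n ih =>
    intro L N α a ha h hN hα
    obtain ⟨k, hk, hak⟩ : ∃ k ∈ T, a k ≠ 0 := by
      by_contra! hcon
      rw [Finset.sum_eq_zero hcon] at ha
      exact n.succ_ne_zero ha.symm
    obtain ⟨s, hs⟩ := Nat.exists_eq_succ_of_ne_zero hak
    set b : E := α k ^ p ^ s with hb_def
    have hb : b ^ p = N k := by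
      rw [← hα k hk, hs, hb_def, ← pow_mul, ← pow_succ]
    obtain ⟨hdeg, hind⟩ := h.update hp hpF hN hk hb
    have hsum : ∑ i ∈ T, Function.update a k s i = n := by
      have h0 : ∑ i ∈ T.erase k, Function.update a k s i = ∑ i ∈ T.erase k, a i :=
        Finset.sum_congr rfl fun i hi => Function.update_of_ne (Finset.ne_of_mem_erase hi) _ _
      rw [← Finset.add_sum_erase T _ hk] at ha
      rw [← Finset.add_sum_erase T _ hk, Function.update_self, h0]
      omega
    have hbL : b ∈ L ⊔ F⟮b⟯ := le_sup_right (a := L) (mem_adjoin_simple_self F b)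
    obtain ⟨h1, h2⟩ := ih (L := L ⊔ F⟮b⟯) (N := Function.update N k b) (α := α) hsum hind
      (fun i hi => by
        by_cases hik : i = k
        · subst hik
          rwa [Function.update_self]
        · rw [Function.update_of_ne hik]
          exact le_sup_left (a := L) (hN i hi))
      (fun i hi => by
        by_cases hik : i = k
        · subst hik
          rw [Function.update_self, Function.update_self]
        · rw [Function.update_of_ne hik, Function.update_of_ne hik]
          exact hα i hi)
    have h3 : L ⊔ F⟮b⟯ ⊔ adjoin F (α '' T) = L ⊔ adjoin F (α '' T) := by
      rw [sup_assoc]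
      congr 1
      refine sup_eq_right.2 (adjoin_simple_le_iff.2 (pow_mem (subset_adjoin F _ ?_) _))
      exact ⟨k, hk, rfl⟩
    rw [h3] at h1 h2
    refine ⟨?_, h2⟩
    rw [← relfinrank_mul_relfinrank (le_sup_left : L ≤ L ⊔ F⟮b⟯) (h3 ▸ le_sup_left), hdeg, h1,
      pow_succ, mul_comm]

end Tower

/-! ### The sets `S(p)` and independence over the fraction field -/

section Domain

variable {D F E : Type*} [CommRing D] [IsDomain D] [UniqueFactorizationMonoid D]
    [Field F] [Algebra D F] [IsFractionRing D F] [Field E] [Algebra F E] {p ℓ : ℕ}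
    {J : Finset (Fin ℓ)} {N : Fin ℓ → D}

omit [IsDomain D] [UniqueFactorizationMonoid D] in
lemma ne_zero_of_prodSet_inter_eq_empty (hp : p.Prime) (h : prodSet p J N ∩ powSet D p = ∅)
    {i : Fin ℓ} (hi : i ∈ J) : N i ≠ 0 := by
  intro h0
  refine (Set.eq_empty_iff_forall_notMem.1 h 0) ⟨⟨i, hi, fun _ => 0, fun _ => hp.pos, ?_⟩, 0, ?_⟩
  · simp [h0]
  · simp [hp.ne_zero]

omit [IsDomain D] in
/-- A unique factorization domain is integrally closed, so that an element of `D` that is an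
`n`-th power in the fraction field is an `n`-th power in `D`. -/
lemma exists_eq_pow_of_algebraMap_eq_pow {n : ℕ} (hn : 0 < n) {x : D} {z : F}
    (h : algebraMap D F x = z ^ n) : ∃ y : D, x = y ^ n := by
  obtain ⟨y, rfl⟩ := IsIntegrallyClosed.exists_algebraMap_eq_of_isIntegral_pow (R := D) hn
    (h ▸ isIntegral_algebraMap)
  exact ⟨y, IsFractionRing.injective D F (by rw [h, map_pow])⟩

/-- A relation modulo `p`-th powers that involves some `N i` nontrivially yields an element of
`S(p)`: raise the relation to a power `t` that makes the exponent of the last such `N i` congruent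
to `1` modulo `p`, and reduce all exponents modulo `p`. -/
lemma exists_mem_prodSet (hp : p.Prime) (hN : ∀ i ∈ J, N i ≠ 0) {ε : D} {e : Fin ℓ → ℕ} {z : F}
    (hrel : algebraMap D F (ε * ∏ i ∈ J, N i ^ e i) = z ^ p) (hne : ∃ i ∈ J, ¬ p ∣ e i) :
    ∃ t, ¬ p ∣ t ∧ ∃ x ∈ prodSet p J N, ∃ y : D, ε ^ t * x = y ^ p := by
  obtain ⟨k, hk, hmax⟩ := (J.filter fun i => ¬ p ∣ e i).exists_maximal
    (by obtain ⟨i, hi, hi'⟩ := hne; exact ⟨i, Finset.mem_filter.2 ⟨hi, hi'⟩⟩)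
  obtain ⟨hkJ, hke⟩ := Finset.mem_filter.1 hk
  have hlast : ∀ j ∈ J, k < j → p ∣ e j := by
    intro j hj hkj
    by_contra hcon
    exact absurd (hmax (Finset.mem_filter.2 ⟨hj, hcon⟩) hkj.le) (not_le.2 hkj)
  obtain ⟨t, -, ht⟩ := Nat.exists_mul_mod_eq_one_of_coprime
    (((Nat.Prime.coprime_iff_not_dvd hp).2 hke).symm) hp.one_lt
  have hpt : ¬ p ∣ t := by
    intro h
    rw [Nat.mod_eq_zero_of_dvd (h.mul_left _)] at ht
    exact zero_ne_one ht
  have hprod : ∏ i ∈ J, N i ^ (e i * t % p) =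
      (∏ j ∈ J.filter (fun j => j < k), N j ^ (e j * t % p)) * N k := by
    have hsub : insert k (J.filter fun j => j < k) ⊆ J := by
      intro j hj
      rcases Finset.mem_insert.1 hj with rfl | hj
      · exact hkJ
      · exact (Finset.mem_filter.1 hj).1
    rw [← Finset.prod_subset hsub, Finset.prod_insert (by simp), ht, pow_one, mul_comm]
    intro j hj hj'
    rw [Finset.mem_insert, Finset.mem_filter, not_or, not_and] at hj'
    have hkj : k < j := lt_of_le_of_ne (not_lt.1 (hj'.2 hj)) (Ne.symm hj'.1)
    rw [Nat.mod_eq_zero_of_dvd ((hlast j hj hkj).mul_right _), pow_zero]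
  have hQ0 : algebraMap D F (∏ i ∈ J, N i ^ (e i * t / p)) ≠ 0 := by
    rw [Ne, map_eq_zero_iff _ (IsFractionRing.injective D F)]
    exact Finset.prod_ne_zero_iff.2 fun i hi => pow_ne_zero _ (hN i hi)
  have hred : (∏ i ∈ J, N i ^ (e i * t % p)) * (∏ i ∈ J, N i ^ (e i * t / p)) ^ p =
      (∏ i ∈ J, N i ^ e i) ^ t := by
    rw [← Finset.prod_pow, ← Finset.prod_pow, ← Finset.prod_mul_distrib]
    refine Finset.prod_congr rfl fun i _ => ?_
    rw [← pow_mul, ← pow_add, ← pow_mul, mul_comm (_ / p), Nat.mod_add_div]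
  refine ⟨t, hpt, _, ⟨k, hkJ, fun j => e j * t % p, fun j => Nat.mod_lt _ hp.pos, rfl⟩, ?_⟩
  refine exists_eq_pow_of_algebraMap_eq_pow (F := F) hp.pos
    (z := z ^ t / algebraMap D F (∏ i ∈ J, N i ^ (e i * t / p))) ?_
  rw [← hprod, div_pow, eq_div_iff (pow_ne_zero _ hQ0), ← pow_mul, mul_comm t, pow_mul, ← hrel,
    ← map_pow, ← map_pow, ← map_mul, mul_assoc, hred, mul_pow]

/-- The image in `E` of the tuple `N`. -/
abbrev toField (F E : Type*) {D : Type*} [CommRing D] [Field F] [Algebra D F] [Field E]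
    [Algebra F E] {ℓ : ℕ} (N : Fin ℓ → D) (i : Fin ℓ) : E :=
  algebraMap F E (algebraMap D F (N i))

lemma dvd_of_prod_eq_pow (hp : p.Prime) (h : prodSet p J N ∩ powSet D p = ∅) {e : Fin ℓ → ℕ}
    {z : E} (hz : z ∈ (⊥ : IntermediateField F E))
    (hrel : ∏ i ∈ J, toField F E N i ^ e i = z ^ p) : ∀ i ∈ J, p ∣ e i := by
  by_contra! hcon
  obtain ⟨z, rfl⟩ := mem_bot.1 hz
  obtain ⟨t, -, x, hx, y, hy⟩ := exists_mem_prodSet (F := F) (z := z) (ε := 1) hp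
    (fun i hi => ne_zero_of_prodSet_inter_eq_empty hp h hi)
    ((algebraMap F E).injective (by simpa using hrel)) hcon
  rw [one_pow, one_mul] at hy
  exact (Set.eq_empty_iff_forall_notMem.1 h x) ⟨hx, y, hy⟩

lemma isIndep_bot_of_odd (hp : p.Prime) (hp2 : p ≠ 2) (h : prodSet p J N ∩ powSet D p = ∅) :
    IsIndep p (⊥ : IntermediateField F E) J (toField F E N) := by
  have hodd := hp.odd_of_ne_two hp2
  intro e ε z hε hz hrel
  rcases hε with rfl | rfl
  · exact dvd_of_prod_eq_pow hp h hz (by simpa using hrel)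
  · refine dvd_of_prod_eq_pow hp h (neg_mem hz) ?_
    rw [hodd.neg_pow, ← hrel]
    simp

lemma isIndep_bot_two (h : prodSet 2 J N ∩ powSet D 2 = ∅)
    (h' : prodSet 2 J N ∩ negSqSet D = ∅) :
    IsIndep 2 (⊥ : IntermediateField F E) J (toField F E N) := by
  intro e ε z hε hz hrel
  rcases hε with rfl | rfl
  · exact dvd_of_prod_eq_pow Nat.prime_two h hz (by simpa using hrel)
  · by_contra! hcon
    obtain ⟨z, rfl⟩ := mem_bot.1 hz
    obtain ⟨t, ht, x, hx, y, hy⟩ := exists_mem_prodSet (F := F) (z := z) (ε := -1) Nat.prime_two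
      (fun i hi => ne_zero_of_prodSet_inter_eq_empty Nat.prime_two h hi)
      ((algebraMap F E).injective (by simpa using hrel)) hcon
    rw [(Nat.odd_iff.2 (Nat.two_dvd_ne_zero.1 ht)).neg_one_pow] at hy
    exact (Set.eq_empty_iff_forall_notMem.1 h' x) ⟨hx, y, by rw [← hy]; ring⟩

end Domain

/-! ### Roots of two-power order when `-1` is a product of the `N i` up to squares -/

section TwoPower

variable {F E ι : Type*} [Field F] [Field E] [Algebra F E] [DecidableEq ι]

lemma prod_pow_ite {M : Type*} [CommMonoid M] {T : Finset ι} {k : ι} (hk : k ∈ T)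
    (n : ι → M) (s : ℕ) (g : ι → ℕ) :
    ∏ i ∈ T, n i ^ (if i = k then s else g i) = n k ^ s * ∏ i ∈ T.erase k, n i ^ g i := by
  rw [← Finset.mul_prod_erase T _ hk, if_pos rfl]
  congr 1
  exact Finset.prod_congr rfl fun i hi => by rw [if_neg (Finset.ne_of_mem_erase hi)]

lemma prod_pow_update {M : Type*} [CommMonoid M] {T : Finset ι} {k : ι} (hk : k ∈ T)
    (n : ι → M) (x : M) (e : ι → ℕ) :
    ∏ i ∈ T, Function.update n k x i ^ e i = x ^ e k * ∏ i ∈ T.erase k, n i ^ e i := by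
  rw [← Finset.mul_prod_erase T _ hk, Function.update_self]
  congr 1
  exact Finset.prod_congr rfl fun i hi => by
    rw [Function.update_of_ne (Finset.ne_of_mem_erase hi)]

/-- If `-1` is not a square in `F`, the squares of elements of `F(√-1)` that lie in `F` are, up to
sign, the squares of elements of `F`. -/
lemma sq_eq_sign_mul_sq {I : E} (hI : I ^ 2 = -1) (h2 : (2 : F) ≠ 0)
    (hF : ∀ x : F, x ^ 2 ≠ -1) {z : E} (hz : z ∈ F⟮I⟯) (hz2 : z ^ 2 ∈ (⊥ : IntermediateField F E)) :
    ∃ ε w : E, (ε = 1 ∨ ε = -1) ∧ w ∈ (⊥ : IntermediateField F E) ∧ z ^ 2 = ε * w ^ 2 := by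
  rcases eq_or_ne z 0 with rfl | hz0
  · exact ⟨1, 0, Or.inl rfl, zero_mem _, by simp⟩
  obtain ⟨c, hc⟩ := mem_bot.1 hz2
  obtain ⟨w, t, rfl⟩ := exists_eq_mul_pow_of_mem_adjoin Nat.prime_two (by exact_mod_cast h2)
    (a := -1) hF (by simpa using hI) hz hc.symm hz0
  refine ⟨(-1) ^ t, algebraMap F E w, neg_one_pow_eq_or E t, mem_bot.2 ⟨w, rfl⟩, ?_⟩
  rw [mul_pow, ← pow_mul, mul_comm t, pow_mul, hI, mul_comm]

/-- A family `n i ∈ F`, `i ∈ T`, that is independent modulo squares, with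
`∏ i ∈ T, n i ^ f i = - d ^ 2` and `f k = 1`. If `α k` is only a square root, or if `± 2 d` is not
a product of the `n i`, `i ≠ k`, up to squares, then the degree of the extension generated by the
`2 ^ a i`-th roots `α i` is divisible by the product of the `2 ^ a i`.

The field `F(α)` contains `I = √-1`, and the `n i` with `i ≠ k` stay independent over `F(I)`. In
the first case, they account for the whole degree over `F(I)`. In the second case, even the `n i`
with `i ≠ k` together with `I * d` are independent over `F(I)`, because `2 * I = (1 + I) ^ 2`. Hence
after adjoining the square roots `√(n i)` with `i ≠ k` these roots and `I * d` are independent, and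
`I * d` may be replaced by `√(n k)`, as it is the product of the `√(n i) ^ f i`. -/
lemma two_pow_dvd_relfinrank (h2 : (2 : F) ≠ 0) {T : Finset ι} {k : ι} (hk : k ∈ T)
    {n α : ι → E} {a f : ι → ℕ} {d : E} (hn : ∀ i ∈ T, n i ∈ (⊥ : IntermediateField F E))
    (hd : d ∈ (⊥ : IntermediateField F E)) (ha : ∀ i ∈ T, a i ≠ 0)
    (hα : ∀ i ∈ T, α i ^ 2 ^ a i = n i)
    (hind : ∀ (e : ι → ℕ), ∀ z ∈ (⊥ : IntermediateField F E), ∏ i ∈ T, n i ^ e i = z ^ 2 →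
      ∀ i ∈ T, 2 ∣ e i)
    (hf : f k = 1) (hfd : ∏ i ∈ T, n i ^ f i = -d ^ 2)
    (hcase : a k = 1 ∨ ∀ (e : ι → ℕ) (ε z : E), (ε = 1 ∨ ε = -1) →
      z ∈ (⊥ : IntermediateField F E) → 2 * d * ∏ i ∈ T.erase k, n i ^ e i ≠ ε * z ^ 2) :
    2 ^ ∑ i ∈ T, a i ∣ Module.finrank F (adjoin F (α '' T)) := by
  have h2E : (2 : E) ≠ 0 := fun h0 =>
    h2 ((algebraMap F E).injective (by rw [map_ofNat, map_zero, h0]))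
  have hd0 : d ≠ 0 := by
    rintro rfl
    have := hind f 0 (zero_mem _) (by rw [hfd]; simp) k hk
    omega
  set b : ι → E := fun i => α i ^ 2 ^ (a i - 1) with hb_def
  have hb : ∀ i ∈ T, b i ^ 2 = n i := fun i hi => by
    rw [← hα i hi, hb_def]
    simp only
    rw [← pow_mul, ← pow_succ, Nat.sub_add_cancel (Nat.pos_of_ne_zero (ha i hi))]
  set A := adjoin F (α '' (T : Set ι)) with hA
  have hαA : ∀ i ∈ T, α i ∈ A := fun i hi => subset_adjoin F _ ⟨i, hi, rfl⟩
  have hbA : ∀ i ∈ T, b i ∈ A := fun i hi => pow_mem (hαA i hi) _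
  set I : E := (∏ i ∈ T, b i ^ f i) / d with hI_def
  have hId : I * d = ∏ i ∈ T, b i ^ f i := div_mul_cancel₀ _ hd0
  have hI : I ^ 2 = -1 := by
    have : (I * d) ^ 2 = -d ^ 2 := by
      rw [hId, ← hfd, ← Finset.prod_pow]
      exact Finset.prod_congr rfl fun i hi => by rw [← hb i hi, pow_right_comm]
    apply mul_right_cancel₀ (pow_ne_zero 2 hd0)
    rw [← mul_pow, this]
    ring
  have hI0 : I ≠ 0 := by
    intro h0
    rw [h0] at hI
    norm_num at hI
  have hIA : I ∈ A := div_mem (prod_mem fun i hi => pow_mem (hbA i hi) _) ((bot_le : ⊥ ≤ A) hd)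
  have hF : ∀ x : F, x ^ 2 ≠ -1 := by
    intro x hx
    have := hind f (algebraMap F E x * d) (mul_mem (mem_bot.2 ⟨x, rfl⟩) hd)
      (by rw [hfd, mul_pow, ← map_pow, hx]; simp) k hk
    omega
  set L : IntermediateField F E := F⟮I⟯ with hL
  have hIL : I ∈ L := mem_adjoin_simple_self F I
  have hLA : L ≤ A := adjoin_simple_le_iff.2 hIA
  have hbotL : (⊥ : IntermediateField F E) ≤ L := bot_le
  have hLdeg : relfinrank ⊥ L = 2 := by
    rw [relfinrank_bot_left, hL]
    exact finrank_adjoin_root (a := -1) Nat.prime_two hF (by simpa using hI)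
  have hsign : ∀ ε : E, (ε = 1 ∨ ε = -1) → ∃ j ∈ L, j ^ 2 = ε := by
    rintro ε (rfl | rfl)
    · exact ⟨1, one_mem _, one_pow 2⟩
    · exact ⟨I, hIL, hI⟩
  have hPbot : ∀ e : ι → ℕ, ∏ i ∈ T.erase k, n i ^ e i ∈ (⊥ : IntermediateField F E) :=
    fun e => prod_mem fun i hi => pow_mem (hn i (Finset.mem_of_mem_erase hi)) _
  have hindL : IsIndep 2 L (T.erase k) n := by
    intro e ε z hε hz hrel i hi
    have hik := Finset.ne_of_mem_erase hi
    obtain ⟨j, hj, rfl⟩ := hsign ε hε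
    have hj4 : j ^ 2 * j ^ 2 = 1 := by rcases hε with h | h <;> rw [h] <;> norm_num
    have h1 : (j * z) ^ 2 = ∏ i ∈ T.erase k, n i ^ e i := by
      rw [mul_pow, ← hrel, ← mul_assoc, hj4, one_mul]
    obtain ⟨ε', w, hε', hw, h3⟩ := sq_eq_sign_mul_sq hI h2 hF (mul_mem hj hz) (h1 ▸ hPbot e)
    rw [h1] at h3
    rcases hε' with rfl | rfl
    · have := hind (fun i => if i = k then 0 else e i) w hw
        (by rw [prod_pow_ite hk, h3]; ring) i (Finset.mem_of_mem_erase hi)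
      simpa [hik] using this
    · -- `-w ^ 2` times `-d ^ 2` is a square, and involves `n k` to the power `f k = 1`
      have := hind (fun i => if i = k then f k else e i + f i) (w * d) (mul_mem hw hd)
        (by
          rw [prod_pow_ite hk]
          simp only [pow_add, Finset.prod_mul_distrib]
          rw [h3, mul_left_comm, Finset.mul_prod_erase T (fun i => n i ^ f i) hk, hfd]
          ring) k hk
      rw [if_pos rfl, hf] at this
      omega
  rcases hcase with hak | hcase
  · obtain ⟨hdeg, -⟩ := hindL.tower Nat.prime_two (by exact_mod_cast h2) _ rfl
      (fun i hi => hbotL (hn i (Finset.mem_of_mem_erase hi)))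
      (fun i hi => hα i (Finset.mem_of_mem_erase hi))
    have hle : L ⊔ adjoin F (α '' (T.erase k : Finset ι)) ≤ A := by
      refine sup_le hLA (adjoin.mono F _ _ (Set.image_mono ?_))
      exact_mod_cast Finset.erase_subset k T
    rw [← Finset.add_sum_erase T _ hk, hak, pow_add, pow_one, ← hdeg, ← hLdeg,
      relfinrank_mul_relfinrank bot_le le_sup_left, ← relfinrank_bot_left,
      ← relfinrank_mul_relfinrank bot_le hle]
    exact dvd_mul_right _ _
  · have hId0 : I * d ≠ 0 := mul_ne_zero hI0 hd0
    have hIdL : I * d ∈ L := mul_mem hIL (hbotL hd)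
    have hindL' : IsIndep 2 L T (Function.update n k (I * d)) := by
      intro e ε z hε hz hrel
      rw [prod_pow_update hk] at hrel
      rcases Nat.even_or_odd' (e k) with ⟨q, hq | hq⟩
      · have h1 := hindL e ε (z / (I * d) ^ q) hε (div_mem hz (pow_mem hIdL q))
          (by rw [div_pow, ← hrel, hq, ← pow_mul, mul_comm q]; field_simp)
        intro i hi
        by_cases hik : i = k
        · exact hik ▸ ⟨q, hq⟩
        · exact h1 i (Finset.mem_erase.2 ⟨hik, hi⟩)
      · exfalso
        set P := ∏ i ∈ T.erase k, n i ^ e i with hP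
        obtain ⟨j, hj, rfl⟩ := hsign ε hε
        have hj4 : j ^ 2 * j ^ 2 = 1 := by rcases hε with h | h <;> rw [h] <;> norm_num
        have hsq : (1 + I) ^ 2 = 2 * I := by linear_combination hI
        have h1I : 1 + I ≠ 0 := by
          intro h0
          rw [h0] at hsq
          exact mul_ne_zero h2E hI0 (by rw [← hsq]; ring)
        have hu : (j * z / (I * d) ^ q / (1 + I)) ^ 2 = d * P / 2 := by
          rw [div_pow, div_pow, mul_pow, hsq, ← hrel, hq, pow_succ (I * d), ← pow_mul (I * d) q 2,
            mul_comm q 2]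
          calc _ = j ^ 2 * j ^ 2 * (d * P / 2) := by field_simp
            _ = _ := by rw [hj4, one_mul]
        have h2bot : (2 : E) ∈ (⊥ : IntermediateField F E) := ofNat_mem _ 2
        obtain ⟨ε', w, hε', hw, h3⟩ := sq_eq_sign_mul_sq hI h2 hF
          (div_mem (div_mem (mul_mem hj hz) (pow_mem hIdL q)) (add_mem (one_mem L) hIL))
          (hu ▸ div_mem (mul_mem hd (hPbot e)) h2bot)
        refine hcase e ε' (2 * w) hε' (mul_mem h2bot hw) ?_
        rw [hu, div_eq_iff h2E] at h3
        rw [mul_assoc, h3]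
        ring
    obtain ⟨hdeg, hind1⟩ := hindL'.tower Nat.prime_two (by exact_mod_cast h2)
      (α := Function.update b k (I * d)) (a := fun i => if i = k then 0 else 1) _ rfl
      (fun i hi => by
        by_cases hik : i = k
        · subst hik
          rwa [Function.update_self]
        · rw [Function.update_of_ne hik]
          exact hbotL (hn i hi))
      (fun i hi => by
        by_cases hik : i = k
        · subst hik
          simp
        · rw [Function.update_of_ne hik, Function.update_of_ne hik, if_neg hik, pow_one, hb i hi])
    set L₁ := L ⊔ adjoin F (Function.update b k (I * d) '' T) with hL₁
    have hroot : ∀ i ∈ T, Function.update b k (I * d) i ∈ L₁ := fun i hi =>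
      le_sup_right (a := L) (subset_adjoin F _ ⟨i, hi, rfl⟩)
    have hbE : ∀ i ∈ T.erase k, b i ∈ L₁ := fun i hi => by
      have := hroot i (Finset.mem_of_mem_erase hi)
      rwa [Function.update_of_ne (Finset.ne_of_mem_erase hi)] at this
    have hb0 : ∀ i ∈ T.erase k, b i ≠ 0 := fun i hi h0 => by
      have := hind1.ne_zero Nat.prime_two (Finset.mem_of_mem_erase hi)
      rw [Function.update_of_ne (Finset.ne_of_mem_erase hi)] at this
      exact this h0
    have hIdb : I * d = b k * ∏ i ∈ T.erase k, b i ^ f i := by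
      rw [hId, ← Finset.mul_prod_erase T _ hk, hf, pow_one]
    have hind2 : IsIndep 2 L₁ T b := by
      intro e ε z hε hz hrel
      set R := ∏ i ∈ T.erase k, b i ^ f i with hR
      have h1 := hind1 (fun i => if i = k then e k else e i + f i * e k) ε (z * R ^ e k) hε
        (mul_mem hz (pow_mem (prod_mem fun i hi => pow_mem (hbE i hi) _) _)) (by
          rw [prod_pow_update hk, if_pos rfl,
            Finset.prod_congr rfl fun i hi => by rw [if_neg (Finset.ne_of_mem_erase hi)]]
          simp only [pow_add, pow_mul, Finset.prod_mul_distrib, Finset.prod_pow]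
          rw [mul_pow z, ← hrel, ← Finset.mul_prod_erase T _ hk, hIdb, ← hR, mul_pow (b k)]
          ring)
      have hek : 2 ∣ e k := by simpa using h1 k hk
      intro i hi
      by_cases hik : i = k
      · exact hik ▸ hek
      · have := h1 i hi
        rw [if_neg hik] at this
        exact (Nat.dvd_add_left (hek.mul_left _)).1 this
    have hbk : b k ∈ L₁ := by
      have h1 := hroot k hk
      rw [Function.update_self, hIdb] at h1
      have h3 : ∏ i ∈ T.erase k, b i ^ f i ≠ 0 :=
        Finset.prod_ne_zero_iff.2 fun i hi => pow_ne_zero _ (hb0 i hi)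
      rw [← mul_div_cancel_right₀ (b k) h3]
      exact div_mem h1 (prod_mem fun i hi => pow_mem (hbE i hi) _)
    obtain ⟨hdeg', -⟩ := hind2.tower Nat.prime_two (by exact_mod_cast h2)
      (α := α) (a := fun i => a i - 1) _ rfl
      (fun i hi => by
        by_cases hik : i = k
        · exact hik ▸ hbk
        · exact hbE i (Finset.mem_erase.2 ⟨hik, hi⟩))
      (fun i hi => rfl)
    have hL₁A : L₁ ≤ A := by
      refine sup_le hLA (adjoin_le_iff.2 ?_)
      rintro _ ⟨i, hi, rfl⟩
      by_cases hik : i = k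
      · subst hik
        rw [Function.update_self]
        exact mul_mem hIA ((bot_le : ⊥ ≤ A) hd)
      · rw [Function.update_of_ne hik]
        exact hbA i hi
    have hsum : ∑ i ∈ T, a i =
        1 + (∑ i ∈ T, (if i = k then 0 else 1) + ∑ i ∈ T, (a i - 1)) := by
      have h1 : ∑ i ∈ T, (if i = k then 1 else 0) = 1 := by
        rw [Finset.sum_ite_eq', if_pos hk]
      rw [← h1, ← Finset.sum_add_distrib, ← Finset.sum_add_distrib]
      refine Finset.sum_congr rfl fun i hi => ?_
      have := ha i hi
      split_ifs <;> omega
    have hA' : L₁ ⊔ A = A := sup_eq_right.2 hL₁A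
    rw [hA'] at hdeg'
    rw [hsum, pow_add, pow_add, pow_one, ← hdeg, ← hdeg', ← hLdeg,
      relfinrank_mul_relfinrank le_sup_left hL₁A, relfinrank_mul_relfinrank bot_le hLA,
      relfinrank_bot_left]

end TwoPower

/-! ### Sufficiency: the degree is divisible by the product of the exponents -/

section Degree

variable {F E ι : Type*} [Field F] [Field E] [Algebra F E] {m : ι → ℕ} {c : ι → F} {α : ι → E}

lemma finiteDimensional_adjoin_roots (hm : ∀ i, 0 < m i)
    (hα : ∀ i, α i ^ m i = algebraMap F E (c i)) (T : Finset ι) :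
    FiniteDimensional F (adjoin F (α '' T)) := by
  have : Finite (α '' (T : Set ι)) := (T.finite_toSet.image α).to_subtype
  refine finiteDimensional_adjoin ?_
  rintro _ ⟨i, -, rfl⟩
  exact isIntegral_of_pow_eq (hm i) (hα i)

lemma natDegree_minpoly_le {K : Type*} [Field K] [Algebra K E] {n : ℕ} (hn : 0 < n) {x : E} {a : K}
    (hx : x ^ n = algebraMap K E a) : (minpoly K x).natDegree ≤ n := by
  have := natDegree_le_of_dvd (minpoly.dvd K x (p := X ^ n - C a) (by simp [hx]))
    (monic_X_pow_sub_C a hn.ne').ne_zero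
  rwa [natDegree_X_pow_sub_C] at this

lemma finrank_adjoin_roots_le (hm : ∀ i, 0 < m i)
    (hα : ∀ i, α i ^ m i = algebraMap F E (c i)) (T : Finset ι) :
    Module.finrank F (adjoin F (α '' T)) ≤ ∏ i ∈ T, m i := by
  classical
  induction T using Finset.induction_on with
  | empty =>
    rw [Finset.coe_empty, Set.image_empty, adjoin_empty, IntermediateField.finrank_bot,
      Finset.prod_empty]
  | insert k T hk ih =>
    rw [Finset.prod_insert hk, Finset.coe_insert, Set.image_insert_eq, Set.insert_eq, adjoin_union]
    refine (finrank_sup_le _ _).trans (Nat.mul_le_mul ?_ ih)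
    rw [adjoin.finrank (isIntegral_of_pow_eq (hm k) (hα k))]
    exact natDegree_minpoly_le (hm k) (hα k)

lemma finrank_dvd_of_le {A B : IntermediateField F E} (h : A ≤ B) :
    Module.finrank F A ∣ Module.finrank F B := by
  rw [← relfinrank_bot_left A, ← relfinrank_bot_left B, ← relfinrank_mul_relfinrank bot_le h]
  exact dvd_mul_right _ _

end Degree

section Main

variable {D F E : Type*} [CommRing D] [IsDomain D] [UniqueFactorizationMonoid D]
    [Field F] [Algebra D F] [IsFractionRing D F] [Field E] [Algebra F E]
    {ℓ : ℕ} {m : Fin ℓ → ℕ} {N : Fin ℓ → D} {α : Fin ℓ → E}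

omit [IsDomain D] [UniqueFactorizationMonoid D] [IsFractionRing D F] in
lemma toField_mem_bot (i : Fin ℓ) : toField F E N i ∈ (⊥ : IntermediateField F E) :=
  mem_bot.2 ⟨_, rfl⟩

/-- If the third clause in the definition of a 2-defective tuple fails, at exponents `f` and index
`k`, then the degree of the extension generated by the 2-power roots is divisible by the product of
their orders. -/
lemma two_pow_dvd_of_not_defective {J : Finset (Fin ℓ)} {a : Fin ℓ → ℕ} (h2 : (2 : F) ≠ 0)
    (hS : prodSet 2 J N ∩ powSet D 2 = ∅) (ha : ∀ i ∈ J, a i ≠ 0)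
    (hα : ∀ i ∈ J, α i ^ 2 ^ a i = toField F E N i) {f : Fin ℓ → ℕ} {d : D}
    (hfd : ∏ i ∈ J, N i ^ f i = -d ^ 2) {k : Fin ℓ} (hk : k ∈ J) (hf : f k = 1)
    (hcase : a k = 1 ∨ ∀ e : Fin ℓ → ℕ, (∀ j, e j < 2) →
      2 * d * ∏ j ∈ J.erase k, N j ^ e j ∉ powSet D 2 ∧
        -(2 * d * ∏ j ∈ J.erase k, N j ^ e j) ∉ powSet D 2) :
    2 ^ ∑ i ∈ J, a i ∣ Module.finrank F (adjoin F (α '' J)) := by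
  refine two_pow_dvd_relfinrank h2 hk (n := toField F E N) (f := f)
    (d := algebraMap F E (algebraMap D F d)) (fun i _ => toField_mem_bot i)
    (mem_bot.2 ⟨_, rfl⟩) ha hα (fun e z hz h => dvd_of_prod_eq_pow Nat.prime_two hS hz h) hf ?_ ?_
  · simpa using congrArg (fun x => algebraMap F E (algebraMap D F x)) hfd
  · refine hcase.imp_right fun hcase e ε z hε hz hrel => ?_
    obtain ⟨z, rfl⟩ := mem_bot.1 hz
    set Q : D := ∏ j ∈ J.erase k, N j ^ (e j / 2) with hQ
    have hQ0 : algebraMap D F Q ≠ 0 := by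
      rw [Ne, map_eq_zero_iff _ (IsFractionRing.injective D F)]
      exact Finset.prod_ne_zero_iff.2 fun i hi => pow_ne_zero _
        (ne_zero_of_prodSet_inter_eq_empty Nat.prime_two hS (Finset.mem_of_mem_erase hi))
    set R : D := ∏ j ∈ J.erase k, N j ^ (e j % 2) with hR
    have hRQ : R * Q ^ 2 = ∏ j ∈ J.erase k, N j ^ e j := by
      rw [hR, hQ, ← Finset.prod_pow, ← Finset.prod_mul_distrib]
      refine Finset.prod_congr rfl fun i _ => ?_
      rw [← pow_mul, ← pow_add, mul_comm (_ / 2), Nat.mod_add_div]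
    obtain ⟨h1, h1'⟩ := hcase (fun j => e j % 2) fun j => Nat.mod_lt _ two_pos
    have hrelF : ∀ η : F, algebraMap F E η = ε →
        algebraMap D F (2 * d * R) * algebraMap D F Q ^ 2 = η * z ^ 2 := by
      rintro η rfl
      apply (algebraMap F E).injective
      rw [map_mul _ η, map_pow _ z, ← hrel, ← map_pow, ← map_mul, mul_assoc, hRQ]
      simp only [map_mul, map_prod, map_pow, map_ofNat]
    rcases hε with rfl | rfl
    · apply h1
      obtain ⟨y, hy⟩ := exists_eq_pow_of_algebraMap_eq_pow (F := F) (x := 2 * d * R) two_pos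
        (z := z / algebraMap D F Q)
        (by rw [div_pow, eq_div_iff (pow_ne_zero 2 hQ0), hrelF 1 (by simp), one_mul])
      exact ⟨y, hy⟩
    · apply h1'
      obtain ⟨y, hy⟩ := exists_eq_pow_of_algebraMap_eq_pow (F := F) (x := -(2 * d * R)) two_pos
        (z := z / algebraMap D F Q)
        (by rw [div_pow, eq_div_iff (pow_ne_zero 2 hQ0), map_neg, neg_mul, hrelF (-1) (by simp)]
            ring)
      exact ⟨y, hy⟩

lemma natCast_ne_zero_of_dvd_lcm (hchar : ¬ ringChar F ∣ Finset.univ.lcm m) {p : ℕ}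
    (hp : p ∣ Finset.univ.lcm m) : (p : F) ≠ 0 := fun h0 =>
  hchar (((ringChar.spec F p).1 h0).trans hp)

/-- The part of the degree at a prime `p ∣ lcm m`: the elements `α i ^ (m i / p ^ v)`, with
`v = v_p(m i)`, are `p ^ v`-th roots of the `N i`. -/
lemma prime_pow_dvd_finrank (hm : ∀ i, 0 < m i) (hchar : ¬ ringChar F ∣ Finset.univ.lcm m)
    (hα : ∀ i, α i ^ m i = toField F E N i) {p : ℕ} (hp : p.Prime) (hpm : p ∣ Finset.univ.lcm m)
    (hS : prodSet p (idx m p) N ∩ powSet D p = ∅)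
    (hdef : p = 2 → ¬ IsTwoDefective (idx m 2) m N) :
    p ^ ∑ i, (m i).factorization p ∣ Module.finrank F (adjoin F (Set.range α)) := by
  set J := idx m p with hJ
  have hmem : ∀ i, i ∈ J ↔ p ∣ m i := fun i => by simp [hJ, idx]
  set β : Fin ℓ → E := fun i => α i ^ (m i / p ^ (m i).factorization p) with hβ
  have hβN : ∀ i ∈ J, β i ^ p ^ (m i).factorization p = toField F E N i := fun i _ => by
    rw [hβ, ← hα i]
    simp only
    rw [← pow_mul, mul_comm, Nat.ordProj_mul_ordCompl_eq_self]
  have hsum : ∑ i, (m i).factorization p = ∑ i ∈ J, (m i).factorization p := by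
    refine (Finset.sum_subset (Finset.subset_univ J) fun i _ hi => ?_).symm
    exact Nat.factorization_eq_zero_of_not_dvd (mt (hmem i).2 hi)
  have ha : ∀ i ∈ J, (m i).factorization p ≠ 0 := fun i hi =>
    (hp.factorization_pos_of_dvd (hm i).ne' ((hmem i).1 hi)).ne'
  have hle : adjoin F (β '' J) ≤ adjoin F (Set.range α) := by
    refine adjoin_le_iff.2 ?_
    rintro _ ⟨i, -, rfl⟩
    exact pow_mem (subset_adjoin F _ (Set.mem_range_self i)) _
  have hpF : (p : F) ≠ 0 := natCast_ne_zero_of_dvd_lcm hchar hpm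
  rw [hsum]
  refine dvd_trans ?_ (finrank_dvd_of_le hle)
  have hfull : IsIndep p (⊥ : IntermediateField F E) J (toField F E N) →
      p ^ ∑ i ∈ J, (m i).factorization p ∣ Module.finrank F (adjoin F (β '' J)) := by
    intro hind
    obtain ⟨h, -⟩ := hind.tower hp hpF _ rfl (fun i _ => toField_mem_bot i) hβN
    rw [bot_sup_eq, relfinrank_bot_left] at h
    rw [h]
  rcases eq_or_ne p 2 with rfl | hp2
  · by_cases hneg : prodSet 2 J N ∩ negSqSet D = ∅
    · exact hfull (isIndep_bot_two hS hneg)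
    · have hdef' := hdef rfl
      rw [IsTwoDefective, ← hJ] at hdef'
      simp only [hS, Set.nonempty_iff_ne_empty.2 hneg, true_and] at hdef'
      push Not at hdef'
      obtain ⟨f, d, -, hfd, k, hk, hfk, hcase⟩ := hdef'
      refine two_pow_dvd_of_not_defective (by exact_mod_cast hpF) hS ha hβN hfd hk hfk ?_
      by_cases h4 : 4 ∣ m k
      · exact Or.inr (hcase h4)
      · left
        have h1 := ha k hk
        by_contra hne
        apply h4
        have : 2 ^ 2 ∣ m k := (Nat.pow_dvd_pow 2 (by omega)).trans (Nat.ordProj_dvd (m k) 2)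
        exact this
  · exact hfull (isIndep_bot_of_odd hp hp2 hS)

/-! ### Necessity: full degree makes each `X ^ m k - N k` irreducible over the other roots -/

omit [IsDomain D] [UniqueFactorizationMonoid D] [IsFractionRing D F] in
lemma le_natDegree_minpoly (hm : ∀ i, 0 < m i) (hα : ∀ i, α i ^ m i = toField F E N i)
    (hfull : Module.finrank F (adjoin F (Set.range α)) = ∏ i, m i) (k : Fin ℓ) :
    m k ≤ (minpoly (adjoin F (α '' (Finset.univ.erase k : Finset (Fin ℓ)))) (α k)).natDegree := by
  set M := adjoin F (α '' (Finset.univ.erase k : Finset (Fin ℓ))) with hM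
  have hint : IsIntegral M (α k) := isIntegral_of_pow_eq (hm k)
    (a := algebraMap F M (algebraMap D F (N k))) (hα k)
  have hsup : M ⊔ F⟮α k⟯ = adjoin F (Set.range α) := by
    rw [hM, ← adjoin_union]
    congr 1
    ext x
    simp only [Set.mem_union, Set.mem_image, Set.mem_singleton_iff, Set.mem_range]
    constructor
    · rintro (⟨i, -, rfl⟩ | rfl) <;> exact ⟨_, rfl⟩
    · rintro ⟨i, rfl⟩
      by_cases hik : i = k
      · exact Or.inr (hik ▸ rfl)
      · exact Or.inl ⟨i, by simpa using hik, rfl⟩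
  have hdeg : Module.finrank F M * (minpoly M (α k)).natDegree =
      (∏ i ∈ Finset.univ.erase k, m i) * m k := by
    rw [Finset.prod_erase_mul _ _ (Finset.mem_univ k), ← hfull, ← hsup, ← adjoin.finrank hint,
      ← relfinrank_sup_adjoin_simple, ← relfinrank_bot_left, ← relfinrank_bot_left,
      relfinrank_mul_relfinrank bot_le le_sup_left]
  by_contra! hlt
  have hpos : 0 < ∏ i ∈ Finset.univ.erase k, m i := Finset.prod_pos fun i _ => hm i
  exact hdeg.not_lt ((Nat.mul_le_mul_right _ (finrank_adjoin_roots_le hm hα _)).trans_lt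
    (Nat.mul_lt_mul_of_pos_left hlt hpos))

omit [IsDomain D] [UniqueFactorizationMonoid D] [IsFractionRing D F] in
lemma pow_ne_of_full (hm : ∀ i, 0 < m i) (hα : ∀ i, α i ^ m i = toField F E N i)
    (hfull : Module.finrank F (adjoin F (Set.range α)) = ∏ i, m i) {k : Fin ℓ} {p : ℕ}
    (hp : p.Prime) (hpk : p ∣ m k) {x : E}
    (hx : x ∈ adjoin F (α '' (Finset.univ.erase k : Finset (Fin ℓ)))) :
    x ^ p ≠ toField F E N k := by
  set M := adjoin F (α '' (Finset.univ.erase k : Finset (Fin ℓ))) with hM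
  set a : M := algebraMap F M (algebraMap D F (N k)) with ha
  have hαa : α k ^ m k = algebraMap M E a := hα k
  have hint : IsIntegral M (α k) := isIntegral_of_pow_eq (hm k) hαa
  have hmin : X ^ m k - C a = minpoly M (α k) :=
    eq_of_monic_of_dvd_of_natDegree_le (minpoly.monic hint) (monic_X_pow_sub_C a (hm k).ne')
      (minpoly.dvd M _ (by simp [hαa]))
      (by rw [natDegree_X_pow_sub_C]; exact le_natDegree_minpoly hm hα hfull k)
  intro h
  exact pow_ne_of_irreducible_X_pow_sub_C (hmin ▸ minpoly.irreducible hint) hpk hp.ne_one ⟨x, hx⟩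
    (Subtype.ext h)

omit [IsDomain D] [UniqueFactorizationMonoid D] [IsFractionRing D F] in
/-- Together with `pow_ne_of_full`, this is the easy half of the irreducibility criterion for
binomials: `X ^ 4 + 4 * c ^ 4 = (X ^ 2 + 2 * c * X + 2 * c ^ 2) * (X ^ 2 - 2 * c * X + 2 * c ^ 2)`. -/
lemma neg_four_mul_pow_ne_of_full (hm : ∀ i, 0 < m i) (hα : ∀ i, α i ^ m i = toField F E N i)
    (hfull : Module.finrank F (adjoin F (Set.range α)) = ∏ i, m i) {k : Fin ℓ}
    (hk : 4 ∣ m k) {x : E}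
    (hx : x ∈ adjoin F (α '' (Finset.univ.erase k : Finset (Fin ℓ)))) :
    -4 * x ^ 4 ≠ toField F E N k := by
  have hle := le_natDegree_minpoly hm hα hfull k
  set M := adjoin F (α '' (Finset.univ.erase k : Finset (Fin ℓ))) with hM
  obtain ⟨t, ht⟩ := hk
  have ht0 : 0 < t := by have := hm k; omega
  intro h
  have key : ∀ c : M, α k ^ (2 * t) + 2 * (c : E) * α k ^ t + 2 * (c : E) ^ 2 ≠ 0 := by
    intro c hc
    set q : M[X] := C (2 * c) * X ^ t + C (2 * c ^ 2) with hq
    have hqd : q.degree < (2 * t : ℕ) := by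
      rw [← mem_degreeLT]
      exact add_mem (mem_degreeLT.2 ((degree_C_mul_X_pow_le _ _).trans_lt
        (by exact_mod_cast (by omega : t < 2 * t)))) (mem_degreeLT.2 (degree_C_le.trans_lt
        (by exact_mod_cast (by omega : 0 < 2 * t))))
    have hdvd := minpoly.dvd M (α k) (p := X ^ (2 * t) + q) (by
      rw [← hc, hq]
      have h2 : ((2 : M) : E) = 2 := rfl
      simp [h2]
      ring)
    have := natDegree_le_of_dvd hdvd (monic_X_pow_add hqd).ne_zero
    have hnat : (X ^ (2 * t) + q).natDegree = 2 * t := natDegree_eq_of_degree_eq_some (by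
      rw [degree_add_eq_left_of_degree_lt (by rwa [degree_X_pow]), degree_X_pow])
    omega
  have hprod : (α k ^ (2 * t) + 2 * x * α k ^ t + 2 * x ^ 2) *
      (α k ^ (2 * t) + 2 * (-x) * α k ^ t + 2 * (-x) ^ 2) = 0 := by
    have h1 : (α k ^ t) ^ 4 + 4 * x ^ 4 = 0 := by
      rw [← pow_mul, mul_comm t 4, ← ht, hα k, ← h]
      ring
    rw [mul_comm 2 t, pow_mul]
    linear_combination h1
  rcases mul_eq_zero.1 hprod with h0 | h0
  · exact key ⟨x, hx⟩ h0
  · exact key (-⟨x, hx⟩) h0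

omit [IsDomain D] [UniqueFactorizationMonoid D] [IsFractionRing D F] in
lemma exists_root_pow_eq (hα : ∀ i, α i ^ m i = toField F E N i) {J : Finset (Fin ℓ)} {k : Fin ℓ}
    (hk : k ∉ J) {q : ℕ} {e : Fin ℓ → ℕ} (hJ : ∀ i ∈ J, e i = 0 ∨ q ∣ m i) :
    ∃ x ∈ adjoin F (α '' (Finset.univ.erase k : Finset (Fin ℓ))),
      x ^ q = ∏ i ∈ J, toField F E N i ^ e i := by
  refine ⟨∏ i ∈ J, (α i ^ (m i / q)) ^ e i, prod_mem fun i hi => pow_mem (pow_mem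
    (subset_adjoin F _ (Set.mem_image_of_mem α ?_)) _) _, ?_⟩
  · simpa using fun h : i = k => hk (h ▸ hi)
  · rw [← Finset.prod_pow]
    refine Finset.prod_congr rfl fun i hi => ?_
    rcases hJ i hi with h0 | ⟨t, ht⟩
    · simp [h0]
    · rcases Nat.eq_zero_or_pos q with rfl | hq
      · rw [← hα i, ht]
        simp
      · rw [ht, Nat.mul_div_cancel_left t hq, pow_right_comm, ← pow_mul (α i), mul_comm t, ← ht, hα i]

omit [IsDomain D] [UniqueFactorizationMonoid D] [IsFractionRing D F] in
lemma prodSet_inter_eq_empty_of_full (hm : ∀ i, 0 < m i) (hα : ∀ i, α i ^ m i = toField F E N i)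
    (hfull : Module.finrank F (adjoin F (Set.range α)) = ∏ i, m i) {p : ℕ} (hp : p.Prime) :
    prodSet p (idx m p) N ∩ powSet D p = ∅ := by
  rw [Set.eq_empty_iff_forall_notMem]
  rintro _ ⟨⟨k, hk, e, -, rfl⟩, y, hy⟩
  have hdvd : ∀ i ∈ idx m p, p ∣ m i := fun i hi => (Finset.mem_filter.1 hi).2
  have h0 : ∀ i ∈ idx m p, toField F E N i ≠ 0 := fun i hi h =>
    pow_ne_of_full hm hα hfull hp (hdvd i hi) (zero_mem _) (by rw [h, zero_pow hp.ne_zero])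
  obtain ⟨x, hx, hxp⟩ := exists_root_pow_eq (J := (idx m p).filter fun j => j < k) (k := k)
    (q := p) (e := e) hα (by simp) fun i hi => Or.inr (hdvd i (Finset.mem_filter.1 hi).1)
  have hx0 : x ^ p ≠ 0 := by
    rw [hxp]
    exact Finset.prod_ne_zero_iff.2 fun i hi => pow_ne_zero _ (h0 i (Finset.mem_filter.1 hi).1)
  refine pow_ne_of_full hm hα hfull hp (hdvd k hk)
    (x := algebraMap F E (algebraMap D F y) / x) (div_mem (IntermediateField.algebraMap_mem _ _) hx) ?_
  rw [div_pow, div_eq_iff hx0, hxp, ← map_pow, ← map_pow, ← hy]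
  simp [mul_comm]

omit [IsDomain D] [UniqueFactorizationMonoid D] [IsFractionRing D F] in
/-- If the tuple is 2-defective, with `- y ^ 2 = N k * ∏ N j ^ e j` and
`± 2 * y * ∏ N j ^ e' j = s ^ 2` (products over `j ≠ k`), then squaring the second relation and
inserting the first shows that `N k = -4 * c ^ 4` with `c` in the field generated by the `α j`,
`j ≠ k`. -/
lemma not_isTwoDefective_of_full (hm : ∀ i, 0 < m i) (hα : ∀ i, α i ^ m i = toField F E N i)
    (hfull : Module.finrank F (adjoin F (Set.range α)) = ∏ i, m i) (h2 : (2 : F) ≠ 0) :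
    ¬ IsTwoDefective (idx m 2) m N := by
  rintro ⟨-, ⟨x, ⟨k, hk, e, he, hx⟩, y, hy⟩, hdef⟩
  have hdvd : ∀ i ∈ idx m 2, 2 ∣ m i := fun i hi => (Finset.mem_filter.1 hi).2
  have h0 : ∀ i ∈ idx m 2, toField F E N i ≠ 0 := fun i hi h =>
    pow_ne_of_full hm hα hfull Nat.prime_two (hdvd i hi) (zero_mem _)
      (by rw [h, zero_pow two_ne_zero])
  have h2E : (2 : E) ≠ 0 := fun h =>
    h2 ((algebraMap F E).injective (by rw [map_ofNat, map_zero, h]))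
  -- the exponents of `x` on all of `J(2)`
  set f : Fin ℓ → ℕ := fun i => if i = k then 1 else if i < k then e i else 0 with hf
  have hfk : f k = 1 := by simp [hf]
  have hfx : ∏ i ∈ idx m 2, N i ^ f i = -y ^ 2 := by
    rw [← hy, hx, prod_pow_ite hk, pow_one, mul_comm]
    congr 1
    have hsub : (idx m 2).filter (fun j => j < k) ⊆ (idx m 2).erase k := fun j hj =>
      Finset.mem_erase.2 ⟨(Finset.mem_filter.1 hj).2.ne, (Finset.mem_filter.1 hj).1⟩
    rw [← Finset.prod_subset hsub]
    · exact Finset.prod_congr rfl fun j hj => by rw [if_pos (Finset.mem_filter.1 hj).2]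
    · intro j hj hj'
      rw [if_neg fun h => hj' (Finset.mem_filter.2 ⟨Finset.mem_of_mem_erase hj, h⟩), pow_zero]
  have hf2 : ∀ i, f i < 2 := by
    intro i
    simp only [hf]
    have := he i
    split_ifs <;> omega
  obtain ⟨h4, e', -, hsq⟩ := hdef f y hf2 hfx k hk hfk
  obtain ⟨A, hA, hA2⟩ := exists_root_pow_eq (J := (idx m 2).erase k) (k := k) (q := 2) (e := e') hα
    (by simp) fun i hi => Or.inr (hdvd i (Finset.mem_of_mem_erase hi))
  obtain ⟨B, hB, hB4⟩ := exists_root_pow_eq (J := (idx m 2).erase k) (k := k) (q := 4) (e := f) hα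
    (by simp) fun i hi => by
      have hi' := Finset.mem_of_mem_erase hi
      rcases Nat.eq_zero_or_pos (f i) with h | h
      · exact Or.inl h
      · exact Or.inr (hdef f y hf2 hfx i hi' (by have := hf2 i; omega)).1
  have hA0 : A ≠ 0 := by
    rintro rfl
    rw [zero_pow two_ne_zero] at hA2
    exact Finset.prod_ne_zero_iff.2
      (fun i hi => pow_ne_zero _ (h0 i (Finset.mem_of_mem_erase hi))) hA2.symm
  have hB0 : B ≠ 0 := by
    rintro rfl
    rw [zero_pow four_ne_zero] at hB4
    exact Finset.prod_ne_zero_iff.2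
      (fun i hi => pow_ne_zero _ (h0 i (Finset.mem_of_mem_erase hi))) hB4.symm
  set Y : E := algebraMap F E (algebraMap D F y) with hY
  have hNk : toField F E N k * B ^ 4 = -Y ^ 2 := by
    have := congrArg (fun x => algebraMap F E (algebraMap D F x)) hfx
    simp only [map_prod, map_pow, map_neg] at this
    rw [← Finset.mul_prod_erase _ _ hk, hfk, pow_one] at this
    rw [hB4]
    exact this
  obtain ⟨s, hs⟩ : ∃ s : D, (2 * y * ∏ j ∈ (idx m 2).erase k, N j ^ e' j) ^ 2 = s ^ 4 := by
    rcases hsq with ⟨s, hs⟩ | ⟨s, hs⟩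
    · exact ⟨s, by rw [hs]; ring⟩
    · exact ⟨s, by rw [← neg_sq, hs]; ring⟩
  set S : E := algebraMap F E (algebraMap D F s) with hSdef
  have hS : (2 * Y * A ^ 2) ^ 2 = S ^ 4 := by
    have := congrArg (fun x => algebraMap F E (algebraMap D F x)) hs
    simp only [map_prod, map_pow, map_mul, map_ofNat] at this
    rw [hA2]
    exact this
  refine neg_four_mul_pow_ne_of_full hm hα hfull h4 (x := S / (2 * A * B))
    (div_mem (IntermediateField.algebraMap_mem _ _) (mul_mem (mul_mem (ofNat_mem _ 2) hA) hB)) ?_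
  apply mul_right_cancel₀ (pow_ne_zero 4 hB0)
  rw [hNk, div_pow, ← hS]
  field_simp
  ring

end Main
end RadicalExt

theorem theoremC {D F E : Type*} [CommRing D] [IsDomain D] [UniqueFactorizationMonoid D]
    [Field F] [Algebra D F] [IsFractionRing D F] [Field E] [Algebra F E]
    {ℓ : ℕ} (m : Fin ℓ → ℕ) (hm : ∀ i, 0 < m i)
    (hchar : ¬ ringChar F ∣ Finset.univ.lcm m)
    (N : Fin ℓ → D) (α : Fin ℓ → E)
    (hα : ∀ i, α i ^ m i = algebraMap F E (algebraMap D F (N i))) :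
    Module.finrank F (IntermediateField.adjoin F (Set.range α)) = ∏ i, m i ↔
      (∀ p : ℕ, p.Prime → p ∣ Finset.univ.lcm m →
        RadicalExt.prodSet p (RadicalExt.idx m p) N ∩ RadicalExt.powSet D p = ∅) ∧
      (2 ∣ Finset.univ.lcm m → ¬ RadicalExt.IsTwoDefective (RadicalExt.idx m 2) m N) := by
  constructor
  · intro hfull
    refine ⟨fun p hp _ => RadicalExt.prodSet_inter_eq_empty_of_full hm hα hfull hp, fun h2 => ?_⟩
    exact RadicalExt.not_isTwoDefective_of_full hm hα hfull
      (by exact_mod_cast RadicalExt.natCast_ne_zero_of_dvd_lcm hchar h2)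
  · rintro ⟨hS, hdef⟩
    have hrange : Set.range α = α '' (Finset.univ : Finset (Fin ℓ)) := by simp
    have hle : Module.finrank F (IntermediateField.adjoin F (Set.range α)) ≤ ∏ i, m i := by
      rw [hrange]
      exact RadicalExt.finrank_adjoin_roots_le hm hα _
    have hpos : 0 < Module.finrank F (IntermediateField.adjoin F (Set.range α)) := by
      have := RadicalExt.finiteDimensional_adjoin_roots hm hα Finset.univ
      rw [hrange]
      exact Module.finrank_pos
    refine le_antisymm hle (Nat.le_of_dvd hpos ?_)
    rw [Nat.dvd_iff_prime_pow_dvd_dvd]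
    intro p r hp hr
    have hr' : r ≤ ∑ i, (m i).factorization p := by
      rw [hp.pow_dvd_iff_le_factorization (Finset.prod_pos fun i _ => hm i).ne',
        Nat.factorization_prod fun i _ => (hm i).ne', Finsupp.finsetSum_apply] at hr
      exact hr
    refine (pow_dvd_pow p hr').trans ?_
    by_cases hpm : p ∣ Finset.univ.lcm m
    · refine RadicalExt.prime_pow_dvd_finrank hm hchar hα hp hpm (hS p hp hpm) ?_
      rintro rfl
      exact hdef hpm
    · rw [Finset.sum_eq_zero, pow_zero]
      · exact one_dvd _
      · intro i hi
        exact Nat.factorization_eq_zero_of_not_dvd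
          fun h => hpm (h.trans (Finset.dvd_lcm hi))
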